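/- All Hilbert spaces are complex, and $\mathcal K\neq\{0\}$; $\mathcal L(\mathcal H)$ denotes the bounded operators on $\mathcal H$, $\otimes$ is the Hilbert space tensor product, and outcome sets are finite. An \emph{observable} on $\mathcal K'$ with outcome set $\Omega$ is a map $\mathsf A:\Omega\to\mathcal L(\mathcal K')$ with $0\le \mathsf A(x)\le 1$ for all $x$ and $\sum_x\mathsf A(x)=1$. An \emph{operation} is a normal completely positive linear map $\Phi:\mathcal L(\mathcal K)\to\mathcal L(\mathcal H)$ with $\Phi(1)\le 1$; it is a \emph{channel} if $\Phi(1)=1$. An \emph{instrument} with outcome set $\Omega$ is a family of operations $\mathcal I(x,\cdot):\mathcal L(\mathcal K)\to\mathcal L(\mathcal H)$, $x\in\Omega$, whose sum is a channel; write $\mathcal I(X,\cdot)=\sum_{x\in X}\mathcal I(x,\cdot)$ for $X\subseteq\Omega$. An instrument $\mathcal I$ on $\Omega$ and a channel $\Lambda$ are \emph{compatible} if there are an instrument $\mathcal J$ on a finite set $\Omega_0$, a map $f:\Omega_0\to\Omega$ and a set $X_0\subseteq\Omega_0$ such that $\mathcal I(X,\cdot)=\mathcal J(f^{-1}(X),\cdot)$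 for all $X\subseteq\Omega$, and $\Lambda=\mathcal J(X_0,\cdot)$. \textbf{Proposition.} Let $\Lambda:\mathcal L(\mathcal K)\to\mathcal L(\mathcal H)$ be a channel with a minimal Stinespring representation $(\mathcal K',V)$, that is, $\mathcal K'$ is a Hilbert space and $V:\mathcal H\to\mathcal K\otimes\mathcal K'$ is a bounded operator (necessarily an isometry) such that $\Lambda(T)=V^*(T\otimes 1)V$ for all $T\in\mathcal L(\mathcal K)$ and the linear span of $\{(T\otimes 1)Vh: T\in\mathcal L(\mathcal K),\ h\in\mathcal H\}$ is dense in $\mathcal K\otimes\mathcal K'$. Let $\mathcal I$ be an instrument with outcome set $\Omega$ consisting of operations $\mathcal L(\mathcal K)\to\mathcal L(\mathcal H)$. Then $\mathcal I$ is compatible with $\Lambda$ if and only if there exists an observable $\mathsf A$ on $\mathcal K'$ with outcome set $\Omega$ such that $$\mathcal I(x,T)=V^*\bigl(T\otimes\mathsf A(x)\bigr)V\qquad\text{for all } x\in\Omega,\ T\in\mathcal L(\mathcal K).$$ If such an $\mathsf A$ exists, then it is unique. -/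

import Mathlib

open scoped TensorProduct CStarAlgebra

noncomputable section

namespace QuantumDevice

/-- The Hilbert space tensor product: the completion of the algebraic tensor product with respect
to the inner product determined by `⟪x ⊗ y, x' ⊗ y'⟫ = ⟪x, x'⟫ * ⟪y, y'⟫`. -/
abbrev HilbertTensor (K K' : Type*) [NormedAddCommGroup K] [InnerProductSpace ℂ K]
    [NormedAddCommGroup K'] [InnerProductSpace ℂ K'] : Type _ :=
  UniformSpace.Completion (K ⊗[ℂ] K')

/-- The bounded operator `T ⊗ A` on the Hilbert space tensor product, i.e. the continuous
extension of `x ⊗ y ↦ T x ⊗ A y`. -/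
def tensorOp {K K' : Type*} [NormedAddCommGroup K] [InnerProductSpace ℂ K]
    [NormedAddCommGroup K'] [InnerProductSpace ℂ K'] (T : K →L[ℂ] K) (A : K' →L[ℂ] K') :
    HilbertTensor K K' →L[ℂ] HilbertTensor K K' :=
  (TensorProduct.mapL T A).completion

section Devices

variable {H K : Type*}
  [NormedAddCommGroup H] [InnerProductSpace ℂ H] [CompleteSpace H]
  [NormedAddCommGroup K] [InnerProductSpace ℂ K] [CompleteSpace K]

/-- An effect: an operator `E` with `0 ≤ E ≤ 1`. -/
def IsEffect (E : H →L[ℂ] H) : Prop := 0 ≤ E ∧ E ≤ 1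

/-- An observable with a finite outcome set: effects summing to the identity. -/
structure IsObservable {Ω : Type*} [Fintype Ω] (A : Ω → (H →L[ℂ] H)) : Prop where
  isEffect : ∀ x, IsEffect (A x)
  sum_eq_one : ∑ x, A x = 1

/-- A linear map between algebras of bounded operators is completely positive. -/
def IsCompletelyPositive (Φ : (K →L[ℂ] K) →ₗ[ℂ] (H →L[ℂ] H)) : Prop :=
  ∃ Ψ : (K →L[ℂ] K) →CP (H →L[ℂ] H), Ψ.toLinearMap = Φ

/-- An operation in the Heisenberg picture: a normal completely positive map `Φ` with `Φ 1 ≤ 1`.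
Normality means that `Φ` preserves least upper bounds of upward directed families. -/
structure IsOperation (Φ : (K →L[ℂ] K) →ₗ[ℂ] (H →L[ℂ] H)) : Prop where
  completelyPositive : IsCompletelyPositive Φ
  normal : ScottContinuous Φ
  map_one_le : Φ 1 ≤ 1

/-- A channel in the Heisenberg picture: a unital operation. -/
structure IsChannel (Λ : (K →L[ℂ] K) →ₗ[ℂ] (H →L[ℂ] H)) : Prop where
  isOperation : IsOperation Λ
  map_one : Λ 1 = 1

/-- An instrument in the Heisenberg picture, with a finite outcome set. -/
structure IsInstrument {Ω : Type*} [Fintype Ω]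
    (I : Ω → ((K →L[ℂ] K) →ₗ[ℂ] (H →L[ℂ] H))) : Prop where
  isOperation : ∀ x, IsOperation (I x)
  isChannel : IsChannel (∑ x, I x)

/-- The operation (in particular: the channel) `Φ` is part of the instrument `J`:
`Φ = J(X, ·) = ∑ x ∈ X, J(x, ·)` for some set `X` of outcomes. -/
def OperationIsPartOf {Ω : Type*} (Φ : (K →L[ℂ] K) →ₗ[ℂ] (H →L[ℂ] H))
    (J : Ω → ((K →L[ℂ] K) →ₗ[ℂ] (H →L[ℂ] H))) : Prop :=
  ∃ X : Finset Ω, Φ = ∑ x ∈ X, J x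

open scoped Classical in
/-- The instrument `I`, with outcome set `Ω'`, is part of the instrument `J`, with outcome set `Ω`:
there is a pointer function `f : Ω → Ω'` with `I(X, ·) = J(f⁻¹(X), ·)` for all `X ⊆ Ω'`. -/
def InstrumentIsPartOf {Ω' Ω : Type*} [Fintype Ω]
    (I : Ω' → ((K →L[ℂ] K) →ₗ[ℂ] (H →L[ℂ] H)))
    (J : Ω → ((K →L[ℂ] K) →ₗ[ℂ] (H →L[ℂ] H))) : Prop :=
  ∃ f : Ω → Ω', ∀ X : Finset Ω', ∑ x ∈ X, I x = ∑ y with f y ∈ X, J y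

/-- An instrument `I` and a channel `Λ` are compatible: some instrument (with some finite outcome
set) has both of them as its parts. -/
def InstrumentChannelCompatible {Ω : Type*}
    (I : Ω → ((K →L[ℂ] K) →ₗ[ℂ] (H →L[ℂ] H))) (Λ : (K →L[ℂ] K) →ₗ[ℂ] (H →L[ℂ] H)) : Prop :=
  ∃ (Ω₀ : Type) (_ : Fintype Ω₀) (J : Ω₀ → ((K →L[ℂ] K) →ₗ[ℂ] (H →L[ℂ] H))),
    IsInstrument J ∧ InstrumentIsPartOf I J ∧ OperationIsPartOf Λ J

variable {K' : Type*} [NormedAddCommGroup K'] [InnerProductSpace ℂ K'] [CompleteSpace K']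

/-- The operator `V⋆ (T ⊗ A) V` on `H`, for `V : H → K ⊗ K'`. -/
def compress (V : H →L[ℂ] HilbertTensor K K') (T : K →L[ℂ] K) (A : K' →L[ℂ] K') : H →L[ℂ] H :=
  ContinuousLinearMap.adjoint V ∘L tensorOp T A ∘L V

/-- `V : H → K ⊗ K'` is a minimal Stinespring representation of `Φ`: `Φ T = V⋆ (T ⊗ 1) V` for all
`T`, and the linear span of the vectors `(T ⊗ 1) V h` is dense in `K ⊗ K'`. -/
structure IsMinimalStinespring (Φ : (K →L[ℂ] K) →ₗ[ℂ] (H →L[ℂ] H))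
    (V : H →L[ℂ] HilbertTensor K K') : Prop where
  eq_compress : ∀ T : K →L[ℂ] K, Φ T = compress V T 1
  dense_span : Dense (Submodule.span ℂ
    {v : HilbertTensor K K' | ∃ (T : K →L[ℂ] K) (h : H), tensorOp T 1 (V h) = v} :
      Set (HilbertTensor K K'))

end Devices

end QuantumDevice

end

/-!
The joint instrument of a compatible pair has vanishing operations at the outcomes that do not
contribute to `Λ`, because `Λ` is already unital; therefore compatibility amounts to
`∑ x, I x = Λ` (`sum_eq_of_instrumentChannelCompatible`; conversely, `I` is then itself a joint
instrument). It remains to see that decompositions of `Λ` into operations correspond to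
observables on the dilation space.

This is the Radon–Nikodym theorem for completely positive maps
(`IsMinimalStinespring.exists_eq_compress_of_stinespringForm_le`). A completely positive `Φ` defines
a positive semidefinite form `⟪S ⊗ h, T ⊗ g⟫ = ⟪h, Φ (S⋆ T) g⟫`. For `Λ` this is the form induced by
`S ⊗ h ↦ (S ⊗ 1) V h`, which has dense range, and each `I x` has a smaller form because the other
summands of `Λ` have nonnegative ones. Hence the form of `I x` is given by a positive operator `E`
on `K ⊗ K'` (`exists_nonneg_inner_eq_of_core`). Since `(R S)⋆ T = S⋆ (R⋆ T)`, `E` commutes with all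
`R ⊗ 1`, so `E = 1 ⊗ A` (`exists_eq_tensorOp_one_of_commute`). By density `A` is determined by `I x`
(`IsMinimalStinespring.compress_injective`), which gives uniqueness and also `∑ x, A x = 1`.
Normality of the operations plays no role: it is inherited from the representation of `Λ`.
-/

namespace QuantumDevice

/-! ### Operators on the Hilbert space tensor product -/

section Tensor

open scoped InnerProductSpace

variable {K K' : Type*} [NormedAddCommGroup K] [InnerProductSpace ℂ K]
  [NormedAddCommGroup K'] [InnerProductSpace ℂ K']

/-- The elementary tensors are total in the Hilbert space tensor product. -/
theorem HilbertTensor.continuousLinearMap_ext {X : Type*} [NormedAddCommGroup X] [NormedSpace ℂ X]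
    {f g : HilbertTensor K K' →L[ℂ] X}
    (h : ∀ (x : K) (y : K'), f ((x ⊗ₜ[ℂ] y : K ⊗[ℂ] K') : HilbertTensor K K') =
      g ((x ⊗ₜ[ℂ] y : K ⊗[ℂ] K') : HilbertTensor K K')) : f = g := by
  refine ContinuousLinearMap.ext fun z => ?_
  induction z using UniformSpace.Completion.induction_on with
  | hp => exact isClosed_eq f.continuous g.continuous
  | ih z =>
    induction z using TensorProduct.induction_on with
    | zero => rw [UniformSpace.Completion.coe_zero, map_zero, map_zero]
    | tmul x y => exact h x y
    | add a b ha hb => rw [UniformSpace.Completion.coe_add, map_add, map_add, ha, hb]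

theorem HilbertTensor.ext_inner_tmul {a b : HilbertTensor K K'}
    (h : ∀ (x : K) (y : K'), ⟪((x ⊗ₜ[ℂ] y : K ⊗[ℂ] K') : HilbertTensor K K'), a⟫_ℂ =
      ⟪((x ⊗ₜ[ℂ] y : K ⊗[ℂ] K') : HilbertTensor K K'), b⟫_ℂ) : a = b := by
  have : innerSL ℂ a = innerSL ℂ b := by
    refine HilbertTensor.continuousLinearMap_ext fun x y => ?_
    rw [innerSL_apply_apply, innerSL_apply_apply, ← inner_conj_symm, h, inner_conj_symm]
  exact ext_inner_right ℂ fun v => congrArg (fun f => f v) this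

@[simp]
theorem tensorOp_tmul (T : K →L[ℂ] K) (A : K' →L[ℂ] K') (x : K) (y : K') :
    tensorOp T A ((x ⊗ₜ[ℂ] y : K ⊗[ℂ] K') : HilbertTensor K K') =
      ((T x ⊗ₜ[ℂ] A y : K ⊗[ℂ] K') : HilbertTensor K K') := by
  simp [tensorOp]

theorem inner_coe_tmul (x x' : K) (y y' : K') :
    ⟪((x ⊗ₜ[ℂ] y : K ⊗[ℂ] K') : HilbertTensor K K'),
      ((x' ⊗ₜ[ℂ] y' : K ⊗[ℂ] K') : HilbertTensor K K')⟫_ℂ = ⟪x, x'⟫_ℂ * ⟪y, y'⟫_ℂ := by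
  simp

theorem tensorOp_mul (S T : K →L[ℂ] K) (A B : K' →L[ℂ] K') :
    tensorOp (S * T) (A * B) = tensorOp S A * tensorOp T B :=
  HilbertTensor.continuousLinearMap_ext fun x y => by simp

theorem tensorOp_mul_apply (S T : K →L[ℂ] K) (A B : K' →L[ℂ] K') (z : HilbertTensor K K') :
    tensorOp (S * T) (A * B) z = tensorOp S A (tensorOp T B z) := by
  rw [tensorOp_mul]; rfl

theorem tensorOp_one : tensorOp (1 : K →L[ℂ] K) (1 : K' →L[ℂ] K') = 1 :=
  HilbertTensor.continuousLinearMap_ext fun x y => by simp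

theorem tensorOp_sum_right {ι : Type*} (s : Finset ι) (T : K →L[ℂ] K) (A : ι → (K' →L[ℂ] K')) :
    tensorOp T (∑ i ∈ s, A i) = ∑ i ∈ s, tensorOp T (A i) :=
  HilbertTensor.continuousLinearMap_ext fun x y => by
    simp only [tensorOp_tmul, _root_.sum_apply, TensorProduct.tmul_sum]
    exact map_sum (UniformSpace.Completion.toComplL (𝕜 := ℂ) (E := K ⊗[ℂ] K')) _ _

theorem tensorOp_right_injective [Nontrivial K] :
    Function.Injective (tensorOp (K' := K') (1 : K →L[ℂ] K)) := by
  intro A B h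
  obtain ⟨e, he⟩ := exists_ne (0 : K)
  ext y
  refine ext_inner_left ℂ fun v => ?_
  have := congrArg (fun F => ⟪((e ⊗ₜ[ℂ] v : K ⊗[ℂ] K') : HilbertTensor K K'),
    F ((e ⊗ₜ[ℂ] y : K ⊗[ℂ] K') : HilbertTensor K K')⟫_ℂ) h
  simpa only [tensorOp_tmul, inner_coe_tmul, one_apply_eq_self,
    mul_right_inj' (inner_self_ne_zero (𝕜 := ℂ).2 he)] using this

theorem nonneg_of_tensorOp_one_nonneg [Nontrivial K] {A : K' →L[ℂ] K'}
    (h : 0 ≤ tensorOp (1 : K →L[ℂ] K) A) : 0 ≤ A := by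
  obtain ⟨e, he⟩ := exists_norm_eq K (zero_le_one (α := ℝ))
  rw [ContinuousLinearMap.nonneg_iff_isPositive, ContinuousLinearMap.isPositive_iff_complex] at h ⊢
  intro y
  simpa [he] using h ((e ⊗ₜ[ℂ] y : K ⊗[ℂ] K') : HilbertTensor K K')

variable [CompleteSpace K] [CompleteSpace K']

/-- The adjoint of `T ⊗ A` is `T⋆ ⊗ A⋆`. -/
theorem inner_tensorOp_left (T : K →L[ℂ] K) (A : K' →L[ℂ] K') (a b : HilbertTensor K K') :
    ⟪tensorOp T A a, b⟫_ℂ = ⟪a, tensorOp (star T) (star A) b⟫_ℂ := by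
  rw [← ContinuousLinearMap.adjoint_inner_right]
  suffices h : ContinuousLinearMap.adjoint (tensorOp T A) = tensorOp (star T) (star A) by rw [h]
  refine HilbertTensor.continuousLinearMap_ext fun x y => ?_
  refine HilbertTensor.ext_inner_tmul fun x' y' => ?_
  simp [ContinuousLinearMap.adjoint_inner_right, ContinuousLinearMap.star_eq_adjoint]

/-- The commutant of `L(K) ⊗ 1` is `1 ⊗ L(K')`. The right factor is found by compressing `E` to
`e ⊗ K'` for a unit vector `e`; the rank-one operators `|x⟩⟨e| ⊗ 1`, which commute with `E`, move
every matrix element of `E` to this corner. -/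
theorem exists_eq_tensorOp_one_of_commute [Nontrivial K]
    (E : HilbertTensor K K' →L[ℂ] HilbertTensor K K')
    (hE : ∀ (T : K →L[ℂ] K) z, E (tensorOp T 1 z) = tensorOp T 1 (E z)) :
    ∃ A : K' →L[ℂ] K', E = tensorOp 1 A := by
  obtain ⟨e, he⟩ := exists_norm_eq K (zero_le_one (α := ℝ))
  let ι : K' →L[ℂ] HilbertTensor K K' :=
    UniformSpace.Completion.toComplL (𝕜 := ℂ) (E := K ⊗[ℂ] K') ∘L TensorProduct.mkL ℂ K K' e
  have hι : ∀ y, ι y = ((e ⊗ₜ[ℂ] y : K ⊗[ℂ] K') : HilbertTensor K K') := fun y => rfl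
  refine ⟨ContinuousLinearMap.adjoint ι ∘L E ∘L ι, ?_⟩
  have hR : ∀ (x : K) (y : K'), ((x ⊗ₜ[ℂ] y : K ⊗[ℂ] K') : HilbertTensor K K') =
      tensorOp (InnerProductSpace.rankOne ℂ x e) 1 (ι y) := by
    intro x y
    simp [hι, he]
  refine HilbertTensor.continuousLinearMap_ext fun x y => ?_
  refine HilbertTensor.ext_inner_tmul fun x' y' => ?_
  have hS : star (InnerProductSpace.rankOne ℂ x' e) * InnerProductSpace.rankOne ℂ x e =
      ⟪x', x⟫_ℂ • InnerProductSpace.rankOne ℂ e e := by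
    ext v
    simp [ContinuousLinearMap.star_eq_adjoint, smul_smul, mul_comm]
  have hkey : ⟪((x' ⊗ₜ[ℂ] y' : K ⊗[ℂ] K') : HilbertTensor K K'),
      E ((x ⊗ₜ[ℂ] y : K ⊗[ℂ] K') : HilbertTensor K K')⟫_ℂ = ⟪x', x⟫_ℂ * ⟪ι y', E (ι y)⟫_ℂ := by
    rw [hR x y, hR x' y', inner_tensorOp_left, star_one, ← hE, ← tensorOp_mul_apply, hS, mul_one]
    simp [hι, he, ← TensorProduct.smul_tmul', UniformSpace.Completion.coe_smul, inner_smul_right]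
  rw [hkey, tensorOp_tmul, inner_coe_tmul]
  simp [ContinuousLinearMap.adjoint_inner_right]

end Tensor

/-! ### Positive forms and completely positive maps -/

section Forms

open scoped InnerProductSpace ComplexOrder

/-- A positive semidefinite form `c` on `D` that is dominated by the form induced by a linear map
`π : D → X` with dense range comes from a positive operator on `X`: the identity of `D` induces a
contraction `W` from `X` to the Hilbert space completion of `(D, c)`, and the operator is `W⋆ W`. -/
theorem exists_nonneg_inner_eq_of_core {D X : Type*} [AddCommGroup D] [Module ℂ D]
    [NormedAddCommGroup X] [InnerProductSpace ℂ X] [CompleteSpace X]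
    (c : PreInnerProductSpace.Core ℂ D) (π : D →ₗ[ℂ] X) (hπ : DenseRange π)
    (hc : ∀ d, (c.inner d d).re ≤ ‖π d‖ ^ 2) :
    ∃ E : X →L[ℂ] X, 0 ≤ E ∧ ∀ d d', ⟪π d, E (π d')⟫_ℂ = c.inner d d' := by
  let _ : SeminormedAddCommGroup D := InnerProductSpace.Core.toSeminormedAddCommGroup (c := c)
  let _ : InnerProductSpace ℂ D := InnerProductSpace.ofCore c
  let j : D →ₗ[ℂ] UniformSpace.Completion D :=
    (UniformSpace.Completion.toComplL (𝕜 := ℂ) (E := D)).toLinearMap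
  have hj : ∀ d, j d = (d : UniformSpace.Completion D) := fun d => rfl
  have hbound : ∀ d, ‖j d‖ ≤ 1 * ‖π d‖ := by
    intro d
    rw [one_mul, hj, UniformSpace.Completion.norm_coe]
    refine le_of_sq_le_sq ?_ (norm_nonneg _)
    rw [← inner_self_eq_norm_sq (𝕜 := ℂ) d]
    exact hc d
  let W : X →L[ℂ] UniformSpace.Completion D := j.extendOfNorm π
  have hW : ∀ d, W (π d) = (d : UniformSpace.Completion D) := fun d =>
    LinearMap.extendOfNorm_eq hπ ⟨1, hbound⟩ d
  refine ⟨ContinuousLinearMap.adjoint W ∘L W, ?_, fun d d' => ?_⟩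
  · rw [ContinuousLinearMap.nonneg_iff_isPositive]
    exact ContinuousLinearMap.isPositive_adjoint_comp_self W
  · rw [ContinuousLinearMap.comp_apply, ContinuousLinearMap.adjoint_inner_right, hW, hW,
      UniformSpace.Completion.inner_coe]

/-- A completely positive map sends the positive matrix `(T i)⋆ (T j)` to a positive matrix. -/
theorem completelyPositive_map_star_mul_nonneg {A B ι : Type*} [Fintype ι]
    [NonUnitalCStarAlgebra A] [NonUnitalCStarAlgebra B] [PartialOrder A] [PartialOrder B]
    [StarOrderedRing A] [StarOrderedRing B] (Φ : A →CP B) (T : ι → A) :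
    (0 : CStarMatrix ι ι B) ≤ CStarMatrix.ofMatrix (Matrix.of fun i j => Φ (star (T i) * T j)) := by
  classical
  rcases isEmpty_or_nonempty ι with h | ⟨⟨i₀⟩⟩
  · exact le_of_eq (by ext i; exact h.elim i)
  -- `(T i)⋆ (T j)` is `N⋆ N` for the matrix `N` whose only nonzero row, the row `i₀`, is `T`.
  let N : CStarMatrix ι ι A := CStarMatrix.ofMatrix (Matrix.of fun i j => if i = i₀ then T j else 0)
  have hN := Φ.map_cstarMatrix_nonneg (star N * N) (star_mul_self_nonneg N)
  convert hN using 1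
  ext i j
  rw [CStarMatrix.map_apply, CStarMatrix.mul_apply]
  simp [N, CStarMatrix.star_apply, CStarMatrix.ofMatrix_apply]

/-- A positive matrix of operators acts positively on tuples of vectors. -/
theorem sum_inner_nonneg_of_cstarMatrix_nonneg {H ι : Type*} [NormedAddCommGroup H]
    [InnerProductSpace ℂ H] [CompleteSpace H] [Fintype ι]
    (M : CStarMatrix ι ι (H →L[ℂ] H)) (hM : 0 ≤ M) (h : ι → H) :
    0 ≤ ∑ i, ∑ j, ⟪h i, M i j (h j)⟫_ℂ := by
  rw [StarOrderedRing.nonneg_iff] at hM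
  induction hM using AddSubmonoid.closure_induction with
  | mem x hx =>
    obtain ⟨N, rfl⟩ := hx
    have : ∑ i, ∑ j, ⟪h i, (star N * N) i j (h j)⟫_ℂ =
        ∑ k, ⟪∑ i, N k i (h i), ∑ j, N k j (h j)⟫_ℂ := by
      simp only [CStarMatrix.mul_apply, CStarMatrix.star_apply, sum_inner, inner_sum,
        _root_.sum_apply, mul_apply_eq_comp, ContinuousLinearMap.star_eq_adjoint,
        ContinuousLinearMap.adjoint_inner_right]
      rw [Finset.sum_comm]
      exact (Finset.sum_congr rfl fun j _ => Finset.sum_comm).trans Finset.sum_comm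
    rw [this]
    exact Finset.sum_nonneg fun k _ => by
      rw [inner_self_eq_norm_sq_to_K]; positivity
  | zero => simp
  | add x y _ _ hx hy =>
    simpa [inner_add_right, Finset.sum_add_distrib] using add_nonneg hx hy

end Forms

section CompletelyPositive

open scoped InnerProductSpace ComplexOrder

variable {H K : Type*}
  [NormedAddCommGroup H] [InnerProductSpace ℂ H]
  [NormedAddCommGroup K] [InnerProductSpace ℂ K] [CompleteSpace K]

/-- The sesquilinear form on finitely supported functions `L(K) → H` determined by
`⟪S ⊗ h, T ⊗ g⟫ = ⟪h, Φ (S⋆ T) g⟫`, where `S ⊗ h` stands for `Finsupp.single S h`. These functions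
play the role of `L(K) ⊗ H` in the Stinespring construction; the relations of the tensor product in
its first factor are not imposed, as they are not needed for a semidefinite form. -/
noncomputable def stinespringForm (Φ : (K →L[ℂ] K) →ₗ[ℂ] (H →L[ℂ] H))
    (d d' : (K →L[ℂ] K) →₀ H) : ℂ :=
  d.sum fun S h => d'.sum fun T g => ⟪h, Φ (star S * T) g⟫_ℂ

@[simp]
theorem stinespringForm_single (Φ : (K →L[ℂ] K) →ₗ[ℂ] (H →L[ℂ] H)) (S T : K →L[ℂ] K) (h g : H) :
    stinespringForm Φ (Finsupp.single S h) (Finsupp.single T g) = ⟪h, Φ (star S * T) g⟫_ℂ := by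
  simp [stinespringForm]

theorem stinespringForm_sum {ι : Type*} (s : Finset ι)
    (Φ : ι → ((K →L[ℂ] K) →ₗ[ℂ] (H →L[ℂ] H))) (d d' : (K →L[ℂ] K) →₀ H) :
    stinespringForm (∑ i ∈ s, Φ i) d d' = ∑ i ∈ s, stinespringForm (Φ i) d d' := by
  simp only [stinespringForm, Finsupp.sum, LinearMap.sum_apply, _root_.sum_apply, inner_sum]
  exact (Finset.sum_congr rfl fun S _ => Finset.sum_comm).trans Finset.sum_comm

variable [CompleteSpace H]

theorem IsCompletelyPositive.map_star {Φ : (K →L[ℂ] K) →ₗ[ℂ] (H →L[ℂ] H)}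
    (hΦ : IsCompletelyPositive Φ) (T : K →L[ℂ] K) : Φ (star T) = star (Φ T) := by
  obtain ⟨Ψ, rfl⟩ := hΦ
  exact StarHomClass.map_star Ψ T

theorem IsCompletelyPositive.map_one_nonneg {Φ : (K →L[ℂ] K) →ₗ[ℂ] (H →L[ℂ] H)}
    (hΦ : IsCompletelyPositive Φ) : 0 ≤ Φ 1 := by
  obtain ⟨Ψ, rfl⟩ := hΦ
  exact map_nonneg Ψ zero_le_one

theorem IsCompletelyPositive.stinespringForm_nonneg {Φ : (K →L[ℂ] K) →ₗ[ℂ] (H →L[ℂ] H)}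
    (hΦ : IsCompletelyPositive Φ) (d : (K →L[ℂ] K) →₀ H) : 0 ≤ stinespringForm Φ d d := by
  obtain ⟨Ψ, rfl⟩ := hΦ
  have := sum_inner_nonneg_of_cstarMatrix_nonneg _
    (completelyPositive_map_star_mul_nonneg Ψ (fun T : d.support => (T : K →L[ℂ] K))) (fun T => d T)
  rw [stinespringForm, Finsupp.sum, ← Finset.sum_coe_sort]
  simp_rw [Finsupp.sum, ← Finset.sum_coe_sort d.support]
  exact this

theorem stinespringForm_le_sum {Ω : Type*} [Fintype Ω]
    {I : Ω → ((K →L[ℂ] K) →ₗ[ℂ] (H →L[ℂ] H))} (hI : ∀ x, IsCompletelyPositive (I x)) (x : Ω)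
    (d : (K →L[ℂ] K) →₀ H) : stinespringForm (I x) d d ≤ stinespringForm (∑ y, I y) d d := by
  rw [stinespringForm_sum]
  exact Finset.single_le_sum (fun y _ => (hI y).stinespringForm_nonneg d) (Finset.mem_univ x)

/-- The form of a completely positive map is a semidefinite inner product. -/
noncomputable abbrev IsCompletelyPositive.core {Φ : (K →L[ℂ] K) →ₗ[ℂ] (H →L[ℂ] H)}
    (hΦ : IsCompletelyPositive Φ) : PreInnerProductSpace.Core ℂ ((K →L[ℂ] K) →₀ H) where
  inner := stinespringForm Φ
  conj_inner_symm d d' := by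
    simp only [stinespringForm, Finsupp.sum, map_sum, inner_conj_symm]
    rw [Finset.sum_comm]
    refine Finset.sum_congr rfl fun S _ => Finset.sum_congr rfl fun T _ => ?_
    rw [← ContinuousLinearMap.adjoint_inner_right, ← ContinuousLinearMap.star_eq_adjoint,
      ← hΦ.map_star, star_mul, star_star]
  re_inner_nonneg d := (Complex.nonneg_iff.1 (hΦ.stinespringForm_nonneg d)).1
  add_left d₁ d₂ d := Finsupp.sum_add_index' (by simp) fun S h h' => by
    simp [Finsupp.sum_add]
  smul_left d d' r := by
    simp only [stinespringForm]
    rw [Finsupp.sum_smul_index' (by simp)]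
    simp only [inner_smul_left, Finsupp.sum, Finset.mul_sum]

/-- By the Cauchy–Schwarz inequality for the form of `Φ`, applied to `1 ⊗ h` and `T ⊗ g`. -/
theorem IsCompletelyPositive.eq_zero_of_map_one_eq_zero {Φ : (K →L[ℂ] K) →ₗ[ℂ] (H →L[ℂ] H)}
    (hΦ : IsCompletelyPositive Φ) (h1 : Φ 1 = 0) : Φ = 0 := by
  ext T g
  refine ext_inner_left ℂ fun h => ?_
  have := @InnerProductSpace.Core.inner_mul_inner_self_le ℂ _ _ _ _ hΦ.core
    (Finsupp.single 1 h) (Finsupp.single T g)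
  rw [@InnerProductSpace.Core.norm_inner_symm ℂ _ _ _ _ hΦ.core
    (Finsupp.single T g)] at this
  change ‖stinespringForm Φ _ _‖ * ‖stinespringForm Φ _ _‖ ≤
    (stinespringForm Φ _ _).re * (stinespringForm Φ _ _).re at this
  simp only [stinespringForm_single, h1, star_one, one_mul, zero_apply,
    inner_zero_right, Complex.zero_re, zero_mul] at this
  simpa using mul_self_eq_zero.1 (le_antisymm this (mul_self_nonneg _))

/-- A joint instrument has the same total channel as `I`, and this total is `Λ`: the outcomes
outside the set that gives `Λ` carry operations that vanish at `1`, hence vanish. -/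
theorem sum_eq_of_instrumentChannelCompatible
    {Λ : (K →L[ℂ] K) →ₗ[ℂ] (H →L[ℂ] H)} (hΛ : IsChannel Λ) {Ω : Type*} [Fintype Ω]
    {I : Ω → ((K →L[ℂ] K) →ₗ[ℂ] (H →L[ℂ] H))} (h : InstrumentChannelCompatible I Λ) :
    ∑ x, I x = Λ := by
  classical
  obtain ⟨Ω₀, _, J, hJ, ⟨f, hf⟩, ⟨X₀, rfl⟩⟩ := h
  have hI : ∑ x, I x = ∑ y, J y := by simpa using hf Finset.univ
  have hzero : ∑ y ∈ X₀ᶜ, J y 1 = 0 := by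
    have h1 := hJ.isChannel.map_one
    rw [← Finset.sum_add_sum_compl X₀ J, LinearMap.add_apply, hΛ.map_one, add_eq_left,
      LinearMap.sum_apply] at h1
    exact h1
  rw [hI, ← Finset.sum_add_sum_compl X₀ J, add_eq_left]
  refine Finset.sum_eq_zero fun y hy => ?_
  have hCP := fun y => (hJ.isOperation y).completelyPositive
  exact (hCP y).eq_zero_of_map_one_eq_zero
    ((Finset.sum_eq_zero_iff_of_nonneg fun y _ => (hCP y).map_one_nonneg).1 hzero y hy)

end CompletelyPositive

/-! ### Minimal Stinespring representations -/

section Stinespring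

open scoped InnerProductSpace ComplexOrder

variable {H K K' : Type*}
  [NormedAddCommGroup H] [InnerProductSpace ℂ H]
  [NormedAddCommGroup K] [InnerProductSpace ℂ K]
  [NormedAddCommGroup K'] [InnerProductSpace ℂ K']

/-- The linear map `S ⊗ h ↦ (S ⊗ 1) V h` from finitely supported functions `L(K) → H`; its range is
the span that is dense when `V` is a minimal Stinespring representation. -/
noncomputable def dilationMap (V : H →L[ℂ] HilbertTensor K K') :
    ((K →L[ℂ] K) →₀ H) →ₗ[ℂ] HilbertTensor K K' :=
  Finsupp.lsum ℂ fun T => (tensorOp T 1 ∘L V).toLinearMap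

@[simp]
theorem dilationMap_single (V : H →L[ℂ] HilbertTensor K K') (T : K →L[ℂ] K) (h : H) :
    dilationMap V (Finsupp.single T h) = tensorOp T 1 (V h) := by
  simp [dilationMap]

variable [CompleteSpace H]

theorem compress_sum {ι : Type*} (s : Finset ι)
    (V : H →L[ℂ] HilbertTensor K K') (T : K →L[ℂ] K)
    (A : ι → (K' →L[ℂ] K')) : compress V T (∑ i ∈ s, A i) = ∑ i ∈ s, compress V T (A i) := by
  ext h
  simp [compress, tensorOp_sum_right]

theorem IsMinimalStinespring.denseRange_dilationMap
    {Λ : (K →L[ℂ] K) →ₗ[ℂ] (H →L[ℂ] H)} {V : H →L[ℂ] HilbertTensor K K'}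
    (hV : IsMinimalStinespring Λ V) :
    DenseRange (dilationMap V) := by
  refine hV.dense_span.mono ?_
  rw [← LinearMap.coe_range]
  refine Submodule.span_le.2 ?_
  rintro _ ⟨T, h, rfl⟩
  exact ⟨Finsupp.single T h, dilationMap_single V T h⟩

/-- Operators are determined by their matrix elements between the vectors `(T ⊗ 1) V h`. -/
theorem IsMinimalStinespring.ext_inner
    {Λ : (K →L[ℂ] K) →ₗ[ℂ] (H →L[ℂ] H)} {V : H →L[ℂ] HilbertTensor K K'}
    (hV : IsMinimalStinespring Λ V)
    {E F : HilbertTensor K K' →L[ℂ] HilbertTensor K K'}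
    (h : ∀ S T h g, ⟪tensorOp S 1 (V h), E (tensorOp T 1 (V g))⟫_ℂ =
      ⟪tensorOp S 1 (V h), F (tensorOp T 1 (V g))⟫_ℂ) : E = F := by
  refine ContinuousLinearMap.ext_on hV.dense_span ?_
  rintro _ ⟨T, g, rfl⟩
  have : innerSL ℂ (E (tensorOp T 1 (V g))) = innerSL ℂ (F (tensorOp T 1 (V g))) := by
    refine ContinuousLinearMap.ext_on hV.dense_span ?_
    rintro _ ⟨S, h', rfl⟩
    rw [innerSL_apply_apply, innerSL_apply_apply, ← inner_conj_symm, h, inner_conj_symm]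
  exact ext_inner_right ℂ fun v => congrArg (fun f => f v) this

variable [CompleteSpace K] [CompleteSpace K']

theorem inner_compress (V : H →L[ℂ] HilbertTensor K K') (S T : K →L[ℂ] K) (A : K' →L[ℂ] K')
    (h g : H) : ⟪h, compress V (star S * T) A g⟫_ℂ =
      ⟪tensorOp S 1 (V h), tensorOp 1 A (tensorOp T 1 (V g))⟫_ℂ := by
  rw [inner_tensorOp_left, ← tensorOp_mul_apply, ← tensorOp_mul_apply]
  simp [compress, ContinuousLinearMap.adjoint_inner_right]

theorem inner_dilationMap_tensorOp (V : H →L[ℂ] HilbertTensor K K') (A : K' →L[ℂ] K')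
    {Φ : (K →L[ℂ] K) →ₗ[ℂ] (H →L[ℂ] H)} (hΦ : ∀ T, Φ T = compress V T A)
    (d d' : (K →L[ℂ] K) →₀ H) :
    ⟪dilationMap V d, tensorOp 1 A (dilationMap V d')⟫_ℂ = stinespringForm Φ d d' := by
  have hd : ∀ d, dilationMap V d = d.sum fun T h => tensorOp T 1 (V h) := fun d => rfl
  rw [hd, hd, Finsupp.sum, Finsupp.sum, sum_inner, map_sum]
  refine Finset.sum_congr rfl fun S _ => ?_
  rw [inner_sum]
  exact Finset.sum_congr rfl fun T _ => by simp only [hΦ, inner_compress]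

theorem IsMinimalStinespring.compress_injective [Nontrivial K]
    {Λ : (K →L[ℂ] K) →ₗ[ℂ] (H →L[ℂ] H)} {V : H →L[ℂ] HilbertTensor K K'}
    (hV : IsMinimalStinespring Λ V) {A B : K' →L[ℂ] K'}
    (h : ∀ T, compress V T A = compress V T B) : A = B :=
  tensorOp_right_injective (hV.ext_inner fun S T h' g => by
    rw [← inner_compress, ← inner_compress, h])

/-- The Radon–Nikodym theorem for completely positive maps: a completely positive map dominated by
`Λ` is `T ↦ V⋆ (T ⊗ A) V` for a positive operator `A` on the dilation space. -/
theorem IsMinimalStinespring.exists_eq_compress_of_stinespringForm_le [Nontrivial K]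
    {Λ : (K →L[ℂ] K) →ₗ[ℂ] (H →L[ℂ] H)} {V : H →L[ℂ] HilbertTensor K K'}
    (hV : IsMinimalStinespring Λ V)
    {Φ : (K →L[ℂ] K) →ₗ[ℂ] (H →L[ℂ] H)} (hΦ : IsCompletelyPositive Φ)
    (hle : ∀ d, stinespringForm Φ d d ≤ stinespringForm Λ d d) :
    ∃ A : K' →L[ℂ] K', 0 ≤ A ∧ ∀ T, Φ T = compress V T A := by
  obtain ⟨E, hE0, hE⟩ := exists_nonneg_inner_eq_of_core hΦ.core (dilationMap V)
    hV.denseRange_dilationMap fun d => by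
      have h := (Complex.le_def.1 (hle d)).1
      rw [← inner_dilationMap_tensorOp V 1 hV.eq_compress, tensorOp_one] at h
      rw [← inner_self_eq_norm_sq (𝕜 := ℂ)]
      exact h
  have hES : ∀ S T h g, ⟪tensorOp S 1 (V h), E (tensorOp T 1 (V g))⟫_ℂ =
      ⟪h, Φ (star S * T) g⟫_ℂ := fun S T h g => by
    rw [← dilationMap_single, ← dilationMap_single, hE]
    exact stinespringForm_single Φ S T h g
  obtain ⟨A, rfl⟩ := exists_eq_tensorOp_one_of_commute E fun R z => by
    -- Both matrix elements are `⟪h, Φ (S⋆ R T) g⟫`.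
    refine congrArg (fun F => F z) (hV.ext_inner (E := E ∘L tensorOp R 1)
      (F := tensorOp R 1 ∘L E) fun S T h g => ?_)
    have hR := inner_tensorOp_left (star R) (1 : K' →L[ℂ] K')
    simp only [star_star, star_one] at hR
    rw [ContinuousLinearMap.comp_apply, ContinuousLinearMap.comp_apply, ← hR,
      ← tensorOp_mul_apply, ← tensorOp_mul_apply, one_mul, hES, hES, star_mul, star_star,
      mul_assoc]
  refine ⟨A, ?_, fun T => ?_⟩
  · exact nonneg_of_tensorOp_one_nonneg hE0
  · ext g
    refine ext_inner_left ℂ fun h => ?_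
    have := hES 1 T h g
    rw [← inner_compress] at this
    simpa using this.symm

end Stinespring

end QuantumDevice

theorem mainTheorem10 {H K K' : Type*}
    [NormedAddCommGroup H] [InnerProductSpace ℂ H] [CompleteSpace H]
    [NormedAddCommGroup K] [InnerProductSpace ℂ K] [CompleteSpace K] [Nontrivial K]
    [NormedAddCommGroup K'] [InnerProductSpace ℂ K'] [CompleteSpace K']
    (Λ : (K →L[ℂ] K) →ₗ[ℂ] (H →L[ℂ] H)) (hΛ : QuantumDevice.IsChannel Λ)
    (V : H →L[ℂ] QuantumDevice.HilbertTensor K K')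
    (hV : QuantumDevice.IsMinimalStinespring Λ V)
    {Ω : Type*} [Fintype Ω]
    (I : Ω → ((K →L[ℂ] K) →ₗ[ℂ] (H →L[ℂ] H))) (hI : QuantumDevice.IsInstrument I) :
    (QuantumDevice.InstrumentChannelCompatible I Λ ↔
      ∃ A : Ω → (K' →L[ℂ] K'), QuantumDevice.IsObservable A ∧
        ∀ x T, I x T = QuantumDevice.compress V T (A x)) ∧
    (∀ A B : Ω → (K' →L[ℂ] K'),
      QuantumDevice.IsObservable A → (∀ x T, I x T = QuantumDevice.compress V T (A x)) →
      QuantumDevice.IsObservable B → (∀ x T, I x T = QuantumDevice.compress V T (B x)) →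
      A = B) := by
  classical
  refine ⟨⟨?_, ?_⟩, fun A B _ hA _ hB =>
    funext fun x => hV.compress_injective fun T => by rw [← hA, hB]⟩
  · intro hcomp
    have hsum := QuantumDevice.sum_eq_of_instrumentChannelCompatible hΛ hcomp
    have hCP := fun x => (hI.isOperation x).completelyPositive
    choose A hA hIA using fun x => hV.exists_eq_compress_of_stinespringForm_le (hCP x) fun d =>
      hsum ▸ QuantumDevice.stinespringForm_le_sum hCP x d
    have hA1 : ∑ x, A x = 1 := hV.compress_injective fun T => by
      rw [QuantumDevice.compress_sum, ← hV.eq_compress, ← hsum, LinearMap.sum_apply]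
      exact Finset.sum_congr rfl fun x _ => (hIA x T).symm
    refine ⟨A, ⟨fun x => ⟨hA x, ?_⟩, hA1⟩, hIA⟩
    rw [← hA1]
    exact Finset.single_le_sum (fun y _ => hA y) (Finset.mem_univ x)
  · rintro ⟨A, hA, hIA⟩
    have hsum : ∑ x, I x = Λ := by
      ext1 T
      rw [hV.eq_compress, LinearMap.sum_apply, ← hA.sum_eq_one]
      simp_rw [hIA]
      exact (QuantumDevice.compress_sum _ V T A).symm
    -- `I` is its own joint instrument; its outcomes are relabelled by `Fin` for universe reasons.
    let e := Fintype.equivFin Ω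
    refine ⟨Fin (Fintype.card Ω), inferInstance, I ∘ e.symm, ⟨fun y => hI.isOperation _, ?_⟩,
      ⟨e.symm, fun X => ?_⟩, ⟨Finset.univ, ?_⟩⟩
    · simpa only [Function.comp_apply, e.symm.sum_comp I] using hI.isChannel
    · rw [Finset.sum_filter]
      exact ((e.symm.sum_comp fun x => if x ∈ X then I x else 0).trans (by simp)).symm
    · simpa only [Function.comp_apply, e.symm.sum_comp I] using hsum.symm
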